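/- Let $\mathbb{K}=\mathbb{R}$ or $\mathbb{C}$ and let $(X,\tau)$ be a bornological locally convex Hausdorff space over $\mathbb{K}$. For a locally convex Hausdorff space $Y$ let $Y_b'$ denote its dual with the topology of uniform convergence on bounded sets. For a locally convex Hausdorff topology $\widetilde\tau$ on $X$ we say that $(X,\tau)$ satisfies - (BBC) for $\widetilde\tau$ if every $\tau$-bounded set is contained in an absolutely convex $\tau$-bounded $\widetilde\tau$-compact set; - (BBCl) for $\widetilde\tau$ if every $\tau$-bounded set is contained in an absolutely convex $\tau$-bounded $\widetilde\tau$-closed set; - (CNC) for $\widetilde\tau$ if $\tau$ has a $0$-neighbourhood basis of absolutely convex $\widetilde\tau$-closed sets. Let $\widetilde\gamma=\widetilde\gamma(\tau,\widetilde\tau)$ be the finest locally convex Hausdorff topology on $X$ which coincides with $\widetilde\tau$ on $\tau$-bounded sets. We say that $(X,\widetilde\gamma)$ satisfies $(\mathrm{B}\tau\mathrm{B}\widetilde\gamma)$ if a subset of $X$ is $\tau$-bounded if and only if it is $\widetilde\gamma$-bounded. A locally convex Hausdorff space is semi-Montel if its bounded subsets are relatively compact, and it is semi-reflexive if the evaluation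 map into the dual of its strong dual is surjective. Then the following assertions are equivalent: (a) $(X,\tau)$ has a complete barrelled predual, i.e. there are a complete barrelled locally convex Hausdorff space $Y$ and a topological isomorphism $\varphi\colon(X,\tau)\to Y_b'$. (b) $(X,\tau)$ has a semi-Montel prebidual $(Y,\varphi)$ such that $Y_b'$ is complete, i.e. there are a semi-Montel locally convex Hausdorff space $Y$ with $Y_b'$ complete and a topological isomorphism $\varphi\colon(X,\tau)\to(Y_b')_b'$. (c) There is a locally convex Hausdorff topology $\widetilde\tau$ on $X$ such that $(X,\tau)$ satisfies (BBC) and (CNC) for $\widetilde\tau$ and $(X,\widetilde\gamma)$ satisfies $(\mathrm{B}\tau\mathrm{B}\widetilde\gamma)$. (d) There is a locally convex Hausdorff topology $\widetilde\tau$ on $X$ such that $(X,\tau)$ satisfies (BBCl) and (CNC) for $\widetilde\tau$ and $(X,\widetilde\gamma)$ is semi-reflexive and satisfies $(\mathrm{B}\tau\mathrm{B}\widetilde\gamma)$. (e) There is a locally convex Hausdorff topology $\widetilde\tau$ on $X$ such that $(X,\tau)$ satisfies (BBC) and (CNC) for $\widetilde\tau$. -/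

import Mathlib

open Set Filter Topology Bornology
open scoped ComplexOrder

universe u

/-- `t` is a locally convex Hausdorff (vector space) topology on the `𝕜`-vector space `E`. -/
structure IsLCHausdorff (𝕜 : Type) [RCLike 𝕜] {E : Type u} [AddCommGroup E] [Module 𝕜 E]
    (t : TopologicalSpace E) : Prop where
  isTopologicalAddGroup : @IsTopologicalAddGroup E t _
  continuousSMul : @ContinuousSMul 𝕜 E _ _ t
  locallyConvexSpace : @LocallyConvexSpace 𝕜 E _ _ _ _ t
  t2Space : @T2Space E t

/-- `B` is bounded (in the sense of von Neumann) with respect to the topology `t`. -/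
abbrev BoundedIn (𝕜 : Type) [RCLike 𝕜] {E : Type u} [AddCommGroup E] [Module 𝕜 E]
    (t : TopologicalSpace E) (B : Set E) : Prop :=
  @IsVonNBounded 𝕜 E _ _ _ t B

/-- A locally convex space is bornological if every absolutely convex set that absorbs all bounded
sets is a `0`-neighbourhood. -/
def IsBornological (𝕜 : Type) [RCLike 𝕜] (E : Type u) [AddCommGroup E] [Module 𝕜 E]
    [TopologicalSpace E] : Prop :=
  ∀ U : Set E, AbsConvex 𝕜 U → (∀ B : Set E, IsVonNBounded 𝕜 B → Absorbs 𝕜 U B) → U ∈ 𝓝 (0 : E)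

/-- Completeness of a topological vector space, with respect to the uniform structure given by its
additive group structure: every Cauchy filter converges. -/
def IsCompleteTVS (E : Type u) [AddCommGroup E] [TopologicalSpace E] [IsTopologicalAddGroup E] :
    Prop :=
  @CompleteSpace E (IsTopologicalAddGroup.rightUniformSpace E)

/-- Semi-reflexivity of `(E, t)`: the evaluation map from `E` into the dual of the strong dual of
`(E, t)` is surjective. (`StrongDual` carries the topology of uniform convergence on bounded
sets.) -/
def IsSemiReflexive (𝕜 : Type) [RCLike 𝕜] {E : Type u} [AddCommGroup E] [Module 𝕜 E]
    (t : TopologicalSpace E) : Prop :=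
  ∀ φ : StrongDual 𝕜 (StrongDual 𝕜 E), ∃ x : E, ∀ f : StrongDual 𝕜 E, φ f = f x

/-- `(E, τ)` satisfies (BBC) for `τ'`. -/
def BBC (𝕜 : Type) [RCLike 𝕜] {E : Type u} [AddCommGroup E] [Module 𝕜 E]
    (τ τ' : TopologicalSpace E) : Prop :=
  ∀ B : Set E, BoundedIn 𝕜 τ B →
    ∃ C : Set E, B ⊆ C ∧ AbsConvex 𝕜 C ∧ BoundedIn 𝕜 τ C ∧ @IsCompact E τ' C

/-- `(E, τ)` satisfies (BBCl) for `τ'`. -/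
def BBCl (𝕜 : Type) [RCLike 𝕜] {E : Type u} [AddCommGroup E] [Module 𝕜 E]
    (τ τ' : TopologicalSpace E) : Prop :=
  ∀ B : Set E, BoundedIn 𝕜 τ B →
    ∃ C : Set E, B ⊆ C ∧ AbsConvex 𝕜 C ∧ BoundedIn 𝕜 τ C ∧ IsClosed[τ'] C

/-- `(E, τ)` satisfies (CNC) for `τ'`. -/
def CNC (𝕜 : Type) [RCLike 𝕜] {E : Type u} [AddCommGroup E] [Module 𝕜 E]
    (τ τ' : TopologicalSpace E) : Prop :=
  ∃ 𝒰 : Set (Set E), (@nhds E τ 0).HasBasis (fun U => U ∈ 𝒰) id ∧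
    ∀ U ∈ 𝒰, AbsConvex 𝕜 U ∧ IsClosed[τ'] U

/-- The locally convex Hausdorff topologies on `E` that coincide with `τ'` on every `τ`-bounded
set. -/
def agreeingTopologies (𝕜 : Type) [RCLike 𝕜] {E : Type u} [AddCommGroup E] [Module 𝕜 E]
    (τ τ' : TopologicalSpace E) : Set (TopologicalSpace E) :=
  {σ | IsLCHausdorff 𝕜 σ ∧ ∀ B : Set E, BoundedIn 𝕜 τ B →
    σ.induced (Subtype.val : B → E) = τ'.induced (Subtype.val : B → E)}

/-- The topology `γ̃(τ, τ')`, the finest locally convex Hausdorff topology on `E` that coincides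
with `τ'` on `τ`-bounded sets (finer topologies are smaller in Mathlib's order). That it is such a
topology is `isLeast_gammaTilde`. -/
abbrev gammaTilde (𝕜 : Type) [RCLike 𝕜] {E : Type u} [AddCommGroup E] [Module 𝕜 E]
    (τ τ' : TopologicalSpace E) : TopologicalSpace E :=
  sInf (agreeingTopologies 𝕜 τ τ')

theorem isLeast_gammaTilde {𝕜 : Type} [RCLike 𝕜] {E : Type u} [AddCommGroup E] [Module 𝕜 E]
    {τ τ' : TopologicalSpace E} (h' : IsLCHausdorff 𝕜 τ') :
    IsLeast (agreeingTopologies 𝕜 τ τ') (gammaTilde 𝕜 τ τ') := by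
  have hmem : τ' ∈ agreeingTopologies 𝕜 τ τ' := ⟨h', fun _ _ => rfl⟩
  refine ⟨⟨⟨?_, ?_, ?_, ?_⟩, ?_⟩, fun σ hσ => sInf_le hσ⟩
  · exact topologicalAddGroup_sInf fun σ hσ => hσ.1.isTopologicalAddGroup
  · exact continuousSMul_sInf fun σ hσ => hσ.1.continuousSMul
  · exact LocallyConvexSpace.sInf fun σ hσ => hσ.1.locallyConvexSpace
  · exact t2Space_antitone (sInf_le hmem) h'.t2Space
  · intro B hB
    rw [gammaTilde, sInf_eq_iInf', induced_iInf]
    have : Nonempty (agreeingTopologies 𝕜 τ τ') := ⟨⟨τ', hmem⟩⟩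
    have heq : ∀ σ : agreeingTopologies 𝕜 τ τ',
        (σ : TopologicalSpace E).induced (Subtype.val : B → E) = τ'.induced Subtype.val :=
      fun σ => σ.2.2 B hB
    simp only [heq, iInf_const]

/-- A topology `γ` on `(E, τ)` satisfies (BτBγ): the `τ`-bounded and the `γ`-bounded subsets
of `E` are the same. -/
def SameBounded (𝕜 : Type) [RCLike 𝕜] {E : Type u} [AddCommGroup E] [Module 𝕜 E]
    (τ γ : TopologicalSpace E) : Prop :=
  ∀ B : Set E, BoundedIn 𝕜 τ B ↔ BoundedIn 𝕜 γ B

/-- `E` has a complete barrelled predual: a complete barrelled locally convex Hausdorff space `Y`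
with a topological isomorphism from `E` onto the strong dual of `Y`. -/
def HasCompleteBarrelledPredual (𝕜 : Type) [RCLike 𝕜] (E : Type u) [AddCommGroup E] [Module 𝕜 E]
    [TopologicalSpace E] : Prop :=
  ∃ (Y : Type u) (_ : AddCommGroup Y) (_ : Module 𝕜 Y) (_ : TopologicalSpace Y)
    (_ : IsTopologicalAddGroup Y) (_ : ContinuousSMul 𝕜 Y) (_ : LocallyConvexSpace 𝕜 Y)
    (_ : T2Space Y),
    IsCompleteTVS Y ∧ BarrelledSpace 𝕜 Y ∧ Nonempty (E ≃L[𝕜] StrongDual 𝕜 Y)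

/-- `E` has a semi-Montel prebidual with complete strong dual: a locally convex Hausdorff space `Y`
whose closed bounded subsets are compact (this is what `MontelSpace` says, without barrelledness),
with complete strong dual, and a topological isomorphism from `E` onto the strong bidual of `Y`. -/
def HasSemiMontelPrebidual (𝕜 : Type) [RCLike 𝕜] (E : Type u) [AddCommGroup E] [Module 𝕜 E]
    [TopologicalSpace E] : Prop :=
  ∃ (Y : Type u) (_ : AddCommGroup Y) (_ : Module 𝕜 Y) (_ : TopologicalSpace Y)
    (_ : IsTopologicalAddGroup Y) (_ : ContinuousSMul 𝕜 Y) (_ : LocallyConvexSpace 𝕜 Y)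
    (_ : T2Space Y),
    MontelSpace 𝕜 Y ∧ IsCompleteTVS (StrongDual 𝕜 Y) ∧
      Nonempty (E ≃L[𝕜] StrongDual 𝕜 (StrongDual 𝕜 Y))

/-!
If `X` is the strong dual of a barrelled space, take for `τ'` the weak-* topology. Polars of bounded
sets are weak-* closed and form a basis of neighbourhoods of zero, and every bounded set of
functionals lies in the polar of a neighbourhood of zero, which is weak-* compact: this is (e).

Conversely, let (e) hold and write `γ̃` for `γ̃(τ, τ')`. A linear functional whose restrictions to
bounded sets are `γ̃`-continuous is itself `γ̃`-continuous, so the strong dual of `(X, γ̃)` is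
complete, and an absolutely summable combination of functionals bounded by `1` on a
`τ`-neighbourhood of zero is again `γ̃`-continuous. With the principle of uniform boundedness on
`ℓ¹` this makes `γ̃`-bounded sets `τ`-bounded. Since `X` is bornological, polarity identifies `τ`
with the topology of the strong bidual of `(X, γ̃)`, and compactness of the sets in (BBC) makes
`(X, γ̃)` semi-Montel and semi-reflexive.

Finally, by Mackey's theorem that weakly bounded sets are bounded, the strong dual of a
semi-reflexive space is barrelled; it is the predual in (a).
-/

section Polar

variable {𝕜 E F : Type*} [NontriviallyNormedField 𝕜] [AddCommGroup E] [Module 𝕜 E]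
  [AddCommGroup F] [Module 𝕜 F]

theorem absorbs_polar_iff {B : E →ₗ[𝕜] F →ₗ[𝕜] 𝕜} {s : Set E} {t : Set F} :
    Absorbs 𝕜 (B.polar s) t ↔ ∃ r, ∀ x ∈ s, ∀ y ∈ t, ‖B x y‖ ≤ r := by
  constructor
  · intro h
    obtain ⟨r, -, hr⟩ := h.exists_pos
    obtain ⟨a, ha⟩ := NormedField.exists_lt_norm 𝕜 r
    refine ⟨‖a‖, fun x hx y hy => ?_⟩
    obtain ⟨z, hz, rfl⟩ := hr a ha.le hy
    simpa using mul_le_mul_of_nonneg_left (hz x hx) (norm_nonneg a)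
  · rintro ⟨r, hr⟩
    refine Absorbs.of_norm ⟨max r 1, fun a ha y hy => ?_⟩
    have ha0 : a ≠ 0 := norm_pos_iff.1 (one_pos.trans_le ((le_max_right r 1).trans ha))
    rw [mem_smul_set_iff_inv_smul_mem₀ ha0]
    intro x hx
    rw [map_smul, norm_smul, norm_inv, inv_mul_le_one₀ (norm_pos_iff.2 ha0)]
    exact (hr x hx y hy).trans ((le_max_left r 1).trans ha)

theorem absorbs_polar_comm {B : E →ₗ[𝕜] F →ₗ[𝕜] 𝕜} {s : Set E} {t : Set F} :
    Absorbs 𝕜 (B.polar s) t ↔ Absorbs 𝕜 (B.flip.polar t) s := by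
  simp only [absorbs_polar_iff, LinearMap.flip_apply]
  exact exists_congr fun r => ⟨fun h y hy x hx => h x hx y hy, fun h x hx y hy => h y hy x hx⟩

end Polar

section AbsConvex

variable {𝕜 E F : Type*} [RCLike 𝕜] [AddCommGroup E] [Module 𝕜 E] [AddCommGroup F] [Module 𝕜 F]

theorem absConvex_image {s : Set E} (hs : AbsConvex 𝕜 s) (f : E →ₗ[𝕜] F) :
    AbsConvex 𝕜 (f '' s) :=
  ⟨fun a ha => by rw [← image_smul_set]; exact image_mono (hs.1 a ha), hs.2.linear_image f⟩

theorem absConvex_preimage {s : Set F} (hs : AbsConvex 𝕜 s) (f : E →ₗ[𝕜] F) :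
    AbsConvex 𝕜 (f ⁻¹' s) :=
  ⟨balanced_iff_smul_mem.2 fun a ha x hx => by
    simpa only [mem_preimage, map_smul] using hs.1.smul_mem ha hx, hs.2.linear_preimage f⟩

end AbsConvex

section Bipolar

variable {𝕜 : Type*} [RCLike 𝕜]

instance locallyConvexSpace_self : LocallyConvexSpace 𝕜 𝕜 :=
  .ofBasisZero 𝕜 𝕜 _ _ Metric.nhds_basis_ball fun _ _ =>
    convex_RCLike_iff_convex_real.2 (convex_ball _ _)

theorem absConvex_closedBall_zero {E : Type*} [AddCommGroup E] [Module 𝕜 E] (p : Seminorm 𝕜 E)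
    (r : ℝ) : AbsConvex 𝕜 (p.closedBall 0 r) := by
  refine ⟨p.balanced_closedBall_zero r, fun x hx y hy a b ha hb hab => ?_⟩
  rw [Seminorm.mem_closedBall_zero] at *
  have norm_add_norm : ‖a‖ + ‖b‖ = 1 := by
    rw [← RCLike.norm_of_nonneg' ha, ← RCLike.norm_of_nonneg' hb] at hab
    exact_mod_cast hab
  calc p (a • x + b • y) ≤ ‖a‖ * p x + ‖b‖ * p y := by
        simpa only [map_smul_eq_mul] using map_add_le_add p (a • x) (b • y)
    _ ≤ ‖a‖ * r + ‖b‖ * r := by gcongr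
    _ = r := by rw [← add_mul, norm_add_norm, one_mul]

theorem absConvex_polar {E F : Type*} [AddCommGroup E] [Module 𝕜 E] [AddCommGroup F] [Module 𝕜 F]
    (B : E →ₗ[𝕜] F →ₗ[𝕜] 𝕜) (s : Set E) : AbsConvex 𝕜 (B.polar s) := by
  have h : B.polar s = ⋂ x ∈ s, (B x).toSeminorm.closedBall 0 1 := by
    rw [LinearMap.polar_eq_iInter]
    simp only [Seminorm.closedBall_zero_eq, LinearMap.toSeminorm_apply]
  rw [h]
  exact AbsConvex.iInter₂ fun x _ => absConvex_closedBall_zero _ _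

variable {E : Type*} [AddCommGroup E] [Module 𝕜 E] [TopologicalSpace E]

theorem isClosed_polar_topDualPairing (D : Set (StrongDual 𝕜 E)) :
    IsClosed ((topDualPairing 𝕜 E).polar D) := by
  rw [LinearMap.polar_eq_iInter]
  exact isClosed_biInter fun f _ => isClosed_le f.continuous.norm continuous_const

variable [IsTopologicalAddGroup E] [ContinuousSMul 𝕜 E] [LocallyConvexSpace 𝕜 E]

theorem exists_mem_polar_one_lt_norm {U : Set E} (hU : AbsConvex 𝕜 U)
    (hUc : IsClosed U) (hne : U.Nonempty) {x : E} (hx : x ∉ U) :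
    ∃ f ∈ StrongDual.polar 𝕜 U, 1 < ‖f x‖ := by
  let _ : Module ℝ E := Module.compHom E (algebraMap ℝ 𝕜)
  have : IsScalarTower ℝ 𝕜 E := IsScalarTower.of_algebraMap_smul fun _ _ => rfl
  have : LocallyConvexSpace ℝ E := .ofBasisZero ℝ E _ _
    (LocallyConvexSpace.convex_basis_zero 𝕜 E) fun _ hs => hs.2.lift ℝ
  obtain ⟨f, c, hfU, hfx⟩ := RCLike.geometric_hahn_banach_closed_point (𝕜 := 𝕜)
    (hU.2.lift ℝ) hUc hx
  have hc : 0 < c := by simpa using hfU 0 (hU.1.zero_mem hne)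
  have norm_le : ∀ y ∈ U, ‖f y‖ ≤ c := fun y hy => by
    obtain ⟨a, ha, hay⟩ := RCLike.exists_norm_eq_mul_self (f y)
    have := hfU (a • y) (hU.1.smul_mem ha.le hy)
    rw [map_smul, smul_eq_mul, ← hay, RCLike.ofReal_re] at this
    exact this.le
  have norm_smul_apply (y : E) : ‖((c : 𝕜)⁻¹ • f) y‖ = c⁻¹ * ‖f y‖ := by
    rw [smul_apply, norm_smul, norm_inv, RCLike.norm_of_nonneg hc.le]
  refine ⟨(c : 𝕜)⁻¹ • f, fun y hy => ?_, ?_⟩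
  · rw [LinearMap.flip_apply, topDualPairing_apply, norm_smul_apply, inv_mul_le_one₀ hc]
    exact norm_le y hy
  · rw [norm_smul_apply, one_lt_inv_mul₀ hc]
    exact hfx.trans_le (RCLike.re_le_norm _)

theorem bipolar_eq_self {U : Set E} (hU : AbsConvex 𝕜 U) (hUc : IsClosed U) (hne : U.Nonempty) :
    (topDualPairing 𝕜 E).polar (StrongDual.polar 𝕜 U) = U := by
  refine Subset.antisymm (fun x hx => ?_) (LinearMap.subset_bipolar (topDualPairing 𝕜 E).flip U)
  by_contra hxU
  obtain ⟨f, hfU, hfx⟩ := exists_mem_polar_one_lt_norm hU hUc hne hxU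
  exact hfx.not_ge (hx f hfU)

end Bipolar

section StrongDual

variable {𝕜 E : Type*} [NontriviallyNormedField 𝕜] [AddCommGroup E] [Module 𝕜 E]
  [TopologicalSpace E] [ContinuousSMul 𝕜 E]

open scoped Pointwise in
theorem hasBasis_nhds_zero_strongDual :
    (𝓝 (0 : StrongDual 𝕜 E)).HasBasis (IsVonNBounded 𝕜) (StrongDual.polar 𝕜) := by
  refine (ContinuousLinearMap.hasBasis_nhds_zero_of_basis (σ := RingHom.id 𝕜) (E := E)
    (Metric.nhds_basis_closedBall (x := (0 : 𝕜)))).to_hasBasis ?_ fun B hB =>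
      ⟨⟨B, 1⟩, ⟨hB, one_pos⟩, fun f hf x hx => mem_closedBall_zero_iff.1 (hf x hx)⟩
  rintro ⟨B, ε⟩ ⟨hB, hε⟩
  obtain ⟨c, hc, hcε⟩ := NormedField.exists_norm_lt 𝕜 hε
  refine ⟨c⁻¹ • B, hB.image (c⁻¹ • ContinuousLinearMap.id 𝕜 E), fun f hf x hx =>
    mem_closedBall_zero_iff.2 ?_⟩
  have norm_apply_smul_le : ‖f (c⁻¹ • x)‖ ≤ 1 := hf _ (smul_mem_smul_set hx)
  rw [map_smul, norm_smul, norm_inv, inv_mul_le_one₀ hc] at norm_apply_smul_le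
  exact norm_apply_smul_le.trans hcε.le

theorem isVonNBounded_strongDual_iff {D : Set (StrongDual 𝕜 E)} :
    IsVonNBounded 𝕜 D ↔
      ∀ s, IsVonNBounded 𝕜 s → Absorbs 𝕜 ((topDualPairing 𝕜 E).polar D) s :=
  hasBasis_nhds_zero_strongDual.isVonNBounded_iff.trans
    (forall₂_congr fun _ _ => absorbs_polar_comm)

theorem absorbent_polar_of_isVonNBounded {s : Set E} (hs : IsVonNBounded 𝕜 s) :
    Absorbent 𝕜 (StrongDual.polar 𝕜 s) :=
  absorbent_nhds_zero (E := StrongDual 𝕜 E) (hasBasis_nhds_zero_strongDual.mem_of_mem hs)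

variable (𝕜 E) in
/-- The evaluation map from a space into its strong bidual. It is linear by construction, but need
not be continuous. -/
def bidualEval : E →ₗ[𝕜] StrongDual 𝕜 (StrongDual 𝕜 E) where
  toFun x := ⟨(topDualPairing 𝕜 E).flip x, continuous_eval_const x⟩
  map_add' x y := by ext f; exact map_add f x y
  map_smul' c x := by ext f; exact map_smul f c x

@[simp]
theorem bidualEval_apply (x : E) (f : StrongDual 𝕜 E) : bidualEval 𝕜 E x f = f x := rfl

end StrongDual

section BanachMackey

variable {𝕜 : Type*} [RCLike 𝕜]

theorem summable_mul_of_norm_le {ι : Type*} {a c : ι → 𝕜} {r : ℝ} (ha : Summable fun i => ‖a i‖)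
    (hc : ∀ i, ‖c i‖ ≤ r) : Summable fun i => a i * c i :=
  .of_norm_bounded (ha.mul_right r) fun i => (norm_mul _ _).trans_le (by gcongr; exact hc i)

open scoped lp in
theorem exists_norm_le_of_forall_norm_tsum_le {ι κ : Type*} {c : κ → ι → 𝕜}
    (hc : ∀ k, ∃ r, ∀ i, ‖c k i‖ ≤ r)
    (h : ∀ a : ι → 𝕜, (Summable fun i => ‖a i‖) → ∃ r, ∀ k, ‖∑' i, a i * c k i‖ ≤ r) :
    ∃ r, ∀ k i, ‖c k i‖ ≤ r := by
  choose M hM using hc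
  let φ (k : κ) : ℓ¹(ι, 𝕜) →L[𝕜] 𝕜 := lp.tsumCLM 𝕜 ι 𝕜 ∘L
    lp.mapCLM 1 (fun i => ContinuousLinearMap.lsmul 𝕜 𝕜 (c k i)) (le_max_right (M k) 0)
      fun i => by simpa using Or.inl (hM k i)
  have φ_apply (k : κ) (a : ℓ¹(ι, 𝕜)) : φ k a = ∑' i, a i * c k i :=
    tsum_congr fun i => mul_comm (c k i) (a i)
  obtain ⟨r, hr⟩ := banach_steinhaus (g := φ) fun a => by
    obtain ⟨r, hr⟩ := h a (by simpa using (lp.memℓp a).summable (by simp))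
    exact ⟨r, fun k => (φ_apply k a).symm ▸ hr k⟩
  refine ⟨r, fun k i => ?_⟩
  classical
  calc ‖c k i‖ = ‖φ k (lp.single 1 i 1)‖ := by
        rw [φ_apply, tsum_eq_single i fun j hj => by simp [hj], lp.single_apply_self, one_mul]
    _ ≤ r * ‖lp.single (E := fun _ : ι => 𝕜) 1 i 1‖ := (φ k).le_of_opNorm_le (hr k) _
    _ = r := by rw [lp.norm_single one_pos, norm_one, mul_one]

variable {E : Type*} [AddCommGroup E] [Module 𝕜 E] [TopologicalSpace E]

theorem exists_strongDual_eq_tsum_polar {U : Set E} (hU : Absorbent 𝕜 U)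
    (hcont : ∀ f : E →ₗ[𝕜] 𝕜, (∀ A, Absorbs 𝕜 U A → ContinuousOn f A) → Continuous f)
    {a : StrongDual.polar 𝕜 U → 𝕜} (ha : Summable fun f => ‖a f‖) :
    ∃ g : StrongDual 𝕜 E, ∀ x, g x = ∑' f, a f * f.1 x := by
  have bound {A : Set E} (hA : Absorbs 𝕜 U A) :
      ∃ r, ∀ f : StrongDual.polar 𝕜 U, ∀ x ∈ A, ‖f.1 x‖ ≤ r := by
    obtain ⟨r, hr⟩ := absorbs_polar_iff.1
      (hA.mono_left (LinearMap.subset_bipolar (topDualPairing 𝕜 E).flip U))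
    exact ⟨r, fun f x hx => hr f f.2 x hx⟩
  have summable (x : E) : Summable fun f => a f * f.1 x := by
    obtain ⟨r, hr⟩ := bound (hU x)
    exact summable_mul_of_norm_le ha fun f => hr f x rfl
  let g : E →ₗ[𝕜] 𝕜 :=
    { toFun := fun x => ∑' f, a f * f.1 x
      map_add' := fun x y => by simp only [map_add, mul_add, (summable x).tsum_add (summable y)]
      map_smul' := fun c x => by
        simp only [map_smul, smul_eq_mul, mul_left_comm _ c, tsum_mul_left, RingHom.id_apply] }
  refine ⟨⟨g, hcont g fun A hA => ?_⟩, fun x => rfl⟩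
  obtain ⟨r, hr⟩ := bound hA
  refine continuousOn_tsum (fun f => (continuous_const.mul f.1.continuous).continuousOn)
    (ha.mul_right r) fun f x hx => (norm_mul _ _).trans_le ?_
  gcongr
  exact hr f x hx

variable [IsTopologicalAddGroup E] [ContinuousSMul 𝕜 E] [LocallyConvexSpace 𝕜 E]

/- The sums of the families `a f • f`, with `f` in the polar of `U` and `a` in `ℓ¹`, are again in
the dual, so they are bounded on `S`; the principle of uniform boundedness on `ℓ¹` then bounds the
polar of `U` uniformly on `S`. -/
theorem absorbs_of_absorbent_polar {U S : Set E} (hU : AbsConvex 𝕜 U) (hUc : IsClosed U)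
    (hUa : Absorbent 𝕜 U)
    (hcont : ∀ f : E →ₗ[𝕜] 𝕜, (∀ A, Absorbs 𝕜 U A → ContinuousOn f A) → Continuous f)
    (hS : Absorbent 𝕜 (StrongDual.polar 𝕜 S)) : Absorbs 𝕜 U S := by
  have bipolar_U := bipolar_eq_self hU hUc ⟨0, hUa.zero_mem⟩
  rw [← bipolar_U, absorbs_polar_iff]
  have pointwise_bound (x : S) : ∃ r, ∀ f : StrongDual.polar 𝕜 U, ‖f.1 x.1‖ ≤ r := by
    have absorbs_x := hUa x.1
    rw [← bipolar_U] at absorbs_x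
    obtain ⟨r, hr⟩ := absorbs_polar_iff.1 absorbs_x
    exact ⟨r, fun f => hr f f.2 x rfl⟩
  obtain ⟨r, hr⟩ := exists_norm_le_of_forall_norm_tsum_le pointwise_bound fun a ha => by
    obtain ⟨g, hg⟩ := exists_strongDual_eq_tsum_polar hUa hcont ha
    obtain ⟨r, hr⟩ := absorbs_polar_iff.1 (hS g)
    exact ⟨r, fun x => hg x ▸ hr x x.2 g rfl⟩
  exact ⟨r, fun f hf x hx => hr ⟨x, hx⟩ ⟨f, hf⟩⟩

theorem isVonNBounded_of_absorbent_polar {S : Set E} (hS : Absorbent 𝕜 (StrongDual.polar 𝕜 S)) :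
    IsVonNBounded 𝕜 S := by
  rw [(nhds_hasBasis_absConvex_closed 𝕜 E).isVonNBounded_iff]
  rintro U ⟨hU0, hUc, hU⟩
  refine absorbs_of_absorbent_polar hU hUc (absorbent_nhds_zero hU0) (fun f hf => ?_) hS
  have continuousOn_U : ContinuousOn f U := hf U hU.1.absorbs_self
  exact continuous_of_continuousAt_zero f (continuousOn_U.continuousAt hU0)

theorem isVonNBounded_bipolar {B : Set E} (hB : IsVonNBounded 𝕜 B) :
    IsVonNBounded 𝕜 ((topDualPairing 𝕜 E).polar (StrongDual.polar 𝕜 B)) := by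
  refine isVonNBounded_of_absorbent_polar ?_
  have tripolar_eq : StrongDual.polar 𝕜 ((topDualPairing 𝕜 E).polar (StrongDual.polar 𝕜 B)) =
      StrongDual.polar 𝕜 B := LinearMap.tripolar_eq_polar (topDualPairing 𝕜 E).flip B
  rw [tripolar_eq]
  exact absorbent_polar_of_isVonNBounded hB

end BanachMackey

section Semireflexive

variable {𝕜 E : Type*} [RCLike 𝕜] [AddCommGroup E] [Module 𝕜 E] [TopologicalSpace E]
  [IsTopologicalAddGroup E] [ContinuousSMul 𝕜 E] [LocallyConvexSpace 𝕜 E]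

/- By Mackey's theorem the prepolar of the closed unit ball of a lower semicontinuous seminorm is
bounded, so this ball, the polar of its prepolar, is a neighbourhood of zero. -/
theorem barrelledSpace_strongDual_of_surjective_bidualEval
    (hE : Function.Surjective (bidualEval 𝕜 E)) : BarrelledSpace 𝕜 (StrongDual 𝕜 E) where
  continuous_of_lowerSemicontinuous p hp := by
    have isClosed_ball : IsClosed (p.closedBall 0 1) := by
      rw [p.closedBall_zero_eq]
      exact hp.isClosed_preimage 1
    have absorbent_ball : Absorbent 𝕜 (p.closedBall 0 1) := p.absorbent_closedBall_zero one_pos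
    have polar_prepolar :
        StrongDual.polar 𝕜 ((topDualPairing 𝕜 E).polar (p.closedBall 0 1)) = p.closedBall 0 1 := by
      refine Subset.antisymm (fun f hf => ?_) (LinearMap.subset_bipolar (topDualPairing 𝕜 E) _)
      have bipolar_ball :=
        bipolar_eq_self (𝕜 := 𝕜) (E := StrongDual 𝕜 E) (absConvex_closedBall_zero p 1)
          isClosed_ball ⟨0, p.mem_closedBall_self zero_le_one⟩
      refine bipolar_ball.subset fun φ hφ => ?_
      obtain ⟨x, rfl⟩ := hE φ
      exact hf x hφ
    refine Seminorm.continuous' (r := 1) ?_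
    rw [← polar_prepolar] at absorbent_ball ⊢
    exact hasBasis_nhds_zero_strongDual.mem_of_mem (isVonNBounded_of_absorbent_polar absorbent_ball)

end Semireflexive

section Barrelled

variable {𝕜 Y : Type*} [RCLike 𝕜] [AddCommGroup Y] [Module 𝕜 Y] [TopologicalSpace Y]

theorem polar_mem_nhds_zero_of_absorbent [BarrelledSpace 𝕜 Y] {D : Set (StrongDual 𝕜 Y)}
    (hD : Absorbent 𝕜 ((topDualPairing 𝕜 Y).polar D)) :
    (topDualPairing 𝕜 Y).polar D ∈ 𝓝 (0 : Y) := by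
  let p (f : D) : Seminorm 𝕜 Y := f.1.toLinearMap.toSeminorm
  have bddAbove : BddAbove (range p) := by
    rw [Seminorm.bddAbove_range_iff]
    intro y
    obtain ⟨r, hr⟩ := absorbs_polar_iff.1 (hD y)
    exact ⟨r, forall_mem_range.2 fun f => hr f f.2 y rfl⟩
  have continuous_iSup : Continuous ⇑(⨆ f, p f) := by
    rw [Seminorm.coe_iSup_eq bddAbove]
    exact Seminorm.continuous_iSup p (fun f => f.1.continuous.norm) bddAbove
  have le_one_mem : ∀ᶠ y in 𝓝 (0 : Y), (⨆ f, p f) y ≤ 1 :=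
    continuous_iSup.continuousAt.eventually_le_const (by rw [map_zero]; exact one_pos)
  filter_upwards [le_one_mem] with y hy f hf
  exact (le_ciSup bddAbove ⟨f, hf⟩ y).trans hy

end Barrelled

section CompleteDual

variable {𝕜 E : Type*} [NontriviallyNormedField 𝕜] [CompleteSpace 𝕜] [AddCommGroup E] [Module 𝕜 E]
  [TopologicalSpace E] [ContinuousSMul 𝕜 E]

theorem completeSpace_strongDual_of_continuousOn
    (h : ∀ f : E →ₗ[𝕜] 𝕜, (∀ B, IsVonNBounded 𝕜 B → ContinuousOn f B) → Continuous f) :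
    CompleteSpace (StrongDual 𝕜 E) := by
  let Φ (f : StrongDual 𝕜 E) : UniformOnFun E 𝕜 {s | IsVonNBounded 𝕜 s} := UniformOnFun.ofFun _ f
  have isUniformInducing : IsUniformInducing Φ :=
    (ContinuousLinearMap.isUniformEmbedding_toUniformOnFun (σ := RingHom.id 𝕜)).isUniformInducing
  rw [completeSpace_iff_isComplete_range isUniformInducing]
  refine (isClosed_of_closure_subset fun g hg => ?_).isComplete
  obtain ⟨f, hf⟩ : UniformOnFun.toFun _ g ∈ range ((↑) : (E →ₗ[𝕜] 𝕜) → E → 𝕜) := by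
    have isClosed := (LinearMap.isClosed_range_coe E 𝕜 (RingHom.id 𝕜)).preimage
      (UniformOnFun.uniformContinuous_toFun
        (sUnion_isVonNBounded_eq_univ (𝕜 := 𝕜) (E := E))).continuous
    refine isClosed.closure_subset_iff.2 ?_ hg
    rintro _ ⟨f, rfl⟩
    exact ⟨f, rfl⟩
  refine ⟨⟨f, h f fun B hB => ?_⟩, hf⟩
  have neBot : (𝓝[range Φ] g).NeBot := mem_closure_iff_nhdsWithin_neBot.1 hg
  have tendsto : TendstoUniformlyOn _ _ (𝓝[range Φ] g) B :=
    UniformOnFun.tendsto_iff_tendstoUniformlyOn.1 (tendsto_id.mono_left nhdsWithin_le_nhds) B hB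
  rw [hf]
  refine tendsto.continuousOn (Eventually.frequently ?_)
  filter_upwards [self_mem_nhdsWithin]
  rintro _ ⟨k, rfl⟩
  exact k.continuous.continuousOn

end CompleteDual

section BanachAlaoglu

variable {𝕜 E : Type*} [NontriviallyNormedField 𝕜] [AddCommGroup E] [Module 𝕜 E]
  [TopologicalSpace E] [IsTopologicalAddGroup E] [ContinuousSMul 𝕜 E]

theorem continuous_of_forall_norm_le_one {f : E →ₗ[𝕜] 𝕜} {U : Set E} (hU : U ∈ 𝓝 (0 : E))
    (hf : ∀ x ∈ U, ‖f x‖ ≤ 1) : Continuous f := by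
  have closedBall_mem : f.toSeminorm.closedBall 0 1 ∈ 𝓝 0 := by
    rw [Seminorm.closedBall_zero_eq]
    exact mem_of_superset hU hf
  refine continuous_of_continuousAt_zero f ?_
  rw [ContinuousAt, map_zero, tendsto_zero_iff_norm_tendsto_zero]
  exact map_zero f.toSeminorm ▸ (Seminorm.continuous' closedBall_mem).tendsto 0

theorem isCompact_weakDual_polar [ProperSpace 𝕜] {U : Set E} (hU : U ∈ 𝓝 (0 : E)) :
    IsCompact (WeakDual.polar 𝕜 U) := by
  have image_eq : ((↑) : WeakDual 𝕜 E → E → 𝕜) '' WeakDual.polar 𝕜 U =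
      range ((↑) : (E →ₗ[𝕜] 𝕜) → E → 𝕜) ∩ ⋂ x ∈ U, {g | ‖g x‖ ≤ 1} := by
    ext g
    simp only [mem_inter_iff, mem_iInter₂, mem_ofPred_eq]
    constructor
    · rintro ⟨f, hf, rfl⟩
      exact ⟨⟨(WeakDual.toStrongDual f).toLinearMap, rfl⟩, hf⟩
    · rintro ⟨⟨f, rfl⟩, hf⟩
      exact ⟨StrongDual.toWeakDual ⟨f, continuous_of_forall_norm_le_one hU hf⟩, hf, rfl⟩
  have pointwise_bound (x : E) : ∃ r, ∀ f ∈ WeakDual.polar 𝕜 U, ‖f x‖ ≤ r := by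
    obtain ⟨r, hr⟩ := absorbs_polar_iff.1 ((absorbent_nhds_zero (𝕜 := 𝕜) hU x).mono_left
      (LinearMap.subset_bipolar (topDualPairing 𝕜 E).flip U))
    exact ⟨r, fun f hf => hr (WeakDual.toStrongDual f) hf x rfl⟩
  choose r hr using pointwise_bound
  refine (DFunLike.coe_injective (F := WeakDual 𝕜 E)).isEmbedding_induced.isCompact_iff.2 ?_
  rw [image_eq]
  refine (isCompact_univ_pi fun x => isCompact_closedBall (0 : 𝕜) (r x)).of_isClosed_subset
    ((LinearMap.isClosed_range_coe E 𝕜 (RingHom.id 𝕜)).inter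
      (isClosed_biInter fun x _ => isClosed_le (continuous_apply x).norm continuous_const)) ?_
  rw [← image_eq]
  rintro _ ⟨f, hf, rfl⟩ x -
  exact mem_closedBall_zero_iff.2 (hr x f hf)

end BanachAlaoglu

section WeakDual

variable {𝕜 E : Type*} [RCLike 𝕜] [AddCommGroup E] [Module 𝕜 E] [TopologicalSpace E]

instance locallyConvexSpace_weakDual : LocallyConvexSpace 𝕜 (WeakDual 𝕜 E) :=
  LocallyConvexSpace.induced (LinearMap.pi fun x => (topDualPairing 𝕜 E).flip x)

theorem exists_eq_apply_of_strongDual_weakDual (ψ : StrongDual 𝕜 (WeakDual 𝕜 E)) :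
    ∃ x : E, ∀ f, ψ f = f x := by
  obtain ⟨x, rfl⟩ := LinearMap.dualEmbedding_surjective (topDualPairing 𝕜 E) ψ
  exact ⟨x, fun f => rfl⟩

theorem exists_one_lt_norm_apply_of_notMem_weakDual {C : Set (WeakDual 𝕜 E)}
    (hC : AbsConvex 𝕜 C) (hCc : IsClosed C) (hne : C.Nonempty) {f : WeakDual 𝕜 E}
    (hf : f ∉ C) : ∃ x, (∀ g ∈ C, ‖g x‖ ≤ 1) ∧ 1 < ‖f x‖ := by
  obtain ⟨ψ, hψ, hψf⟩ := exists_mem_polar_one_lt_norm hC hCc hne hf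
  obtain ⟨x, hx⟩ := exists_eq_apply_of_strongDual_weakDual ψ
  exact ⟨x, fun g hg => hx g ▸ hψ g hg, hx f ▸ hψf⟩

end WeakDual

section SemiMontel

variable {𝕜 E : Type*} [RCLike 𝕜] [AddCommGroup E] [Module 𝕜 E] [TopologicalSpace E]
  [ContinuousSMul 𝕜 E]

/- A functional `φ` on the strong dual is bounded by `1` on the polar of some such set `C`. If it
were outside the image of `C`, which is weak-* compact, a weak-* continuous functional, hence an
evaluation at an element of the dual, would separate it from that image. -/
theorem surjective_bidualEval_of_exists_isCompact
    (h : ∀ B : Set E, IsVonNBounded 𝕜 B → ∃ C, B ⊆ C ∧ AbsConvex 𝕜 C ∧ IsCompact C) :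
    Function.Surjective (bidualEval 𝕜 E) := by
  intro φ
  let J : E →ₗ[𝕜] WeakDual 𝕜 (StrongDual 𝕜 E) :=
    StrongDual.toWeakDual.toLinearMap ∘ₗ bidualEval 𝕜 E
  have continuous_J : Continuous J := WeakDual.continuous_of_continuous_eval fun f => f.continuous
  have preimage_mem : {f | ‖φ f‖ ≤ 1} ∈ 𝓝 (0 : StrongDual 𝕜 E) :=
    φ.continuous.norm.continuousAt.preimage_mem_nhds (t := Iic 1)
      (by rw [map_zero, norm_zero]; exact Iic_mem_nhds one_pos)
  obtain ⟨B, hB, polar_B_subset⟩ := hasBasis_nhds_zero_strongDual.mem_iff.1 preimage_mem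
  obtain ⟨C, hBC, hC, hCc⟩ := h (insert 0 B) (hB.insert 0)
  suffices StrongDual.toWeakDual φ ∈ J '' C by
    obtain ⟨x, -, hx⟩ := this
    exact ⟨x, StrongDual.toWeakDual.injective hx⟩
  by_contra hφ
  obtain ⟨f, hf, hφf⟩ := exists_one_lt_norm_apply_of_notMem_weakDual (𝕜 := 𝕜)
    (E := StrongDual 𝕜 E) (absConvex_image hC J) (hCc.image continuous_J).isClosed
    ⟨_, mem_image_of_mem J (hBC (mem_insert 0 B))⟩ hφ
  exact hφf.not_ge (polar_B_subset fun x hx =>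
    hf _ (mem_image_of_mem J (hBC (mem_insert_of_mem 0 hx))))

theorem barrelledSpace_strongDual_of_montelSpace [IsTopologicalAddGroup E] [LocallyConvexSpace 𝕜 E]
    [MontelSpace 𝕜 E] : BarrelledSpace 𝕜 (StrongDual 𝕜 E) :=
  barrelledSpace_strongDual_of_surjective_bidualEval <|
    surjective_bidualEval_of_exists_isCompact fun B hB =>
      ⟨(topDualPairing 𝕜 E).polar (StrongDual.polar 𝕜 B),
        LinearMap.subset_bipolar (topDualPairing 𝕜 E).flip B, absConvex_polar _ _,
        MontelSpace.isCompact_of_isClosed_of_isVonNBounded 𝕜 (isClosed_polar_topDualPairing _)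
          (isVonNBounded_bipolar hB)⟩

end SemiMontel

section Bidual

variable {𝕜 : Type} [RCLike 𝕜] {E : Type u} [AddCommGroup E] [Module 𝕜 E]

theorem isSemiReflexive_iff_surjective_bidualEval [t : TopologicalSpace E] [ContinuousSMul 𝕜 E] :
    IsSemiReflexive 𝕜 t ↔ Function.Surjective (bidualEval 𝕜 E) :=
  forall_congr' fun _ => exists_congr fun _ =>
    ⟨fun h => ContinuousLinearMap.ext fun f => (h f).symm, fun h _ => h ▸ rfl⟩

theorem isVonNBounded_polar_of_absorbs [TopologicalSpace E] [ContinuousSMul 𝕜 E] {U : Set E}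
    (hU : ∀ s, IsVonNBounded 𝕜 s → Absorbs 𝕜 U s) : IsVonNBounded 𝕜 (StrongDual.polar 𝕜 U) :=
  isVonNBounded_strongDual_iff.2 fun s hs =>
    (hU s hs).mono_left (LinearMap.subset_bipolar (topDualPairing 𝕜 E).flip U)

variable {τ : TopologicalSpace E} [γ : TopologicalSpace E] [IsTopologicalAddGroup E]
  [ContinuousSMul 𝕜 E] [LocallyConvexSpace 𝕜 E]

theorem bidualEval_injective [T2Space E] : Function.Injective (bidualEval 𝕜 E) := by
  refine (injective_iff_map_eq_zero _).2 fun x hx => ?_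
  by_contra hne
  obtain ⟨f, -, hf⟩ := exists_mem_polar_one_lt_norm (𝕜 := 𝕜) (U := {(0 : E)})
    ⟨balanced_zero, convex_singleton 0⟩ isClosed_singleton (singleton_nonempty 0) hne
  rw [← bidualEval_apply, hx, zero_apply, norm_zero] at hf
  exact hf.not_gt one_pos

theorem isInducing_bidualEval (hτ : @IsTopologicalAddGroup E τ _)
    (hE : @IsBornological 𝕜 _ E _ _ τ) (hB : SameBounded 𝕜 τ γ) (hC : CNC 𝕜 τ γ) :
    @IsInducing E _ τ _ (bidualEval 𝕜 E) := by
  obtain ⟨𝒰, h𝒰, h𝒰'⟩ := hC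
  have polar_mem_nhds (D : Set (StrongDual 𝕜 E)) (hD : IsVonNBounded 𝕜 D) :
      (topDualPairing 𝕜 E).polar D ∈ @nhds E τ 0 :=
    hE _ (absConvex_polar _ D) fun B h => isVonNBounded_strongDual_iff.1 hD B ((hB B).1 h)
  have isVonNBounded_polar (U : Set E) (hU : U ∈ 𝒰) : IsVonNBounded 𝕜 (StrongDual.polar 𝕜 U) :=
    isVonNBounded_polar_of_absorbs fun s hs => (hB s).2 hs (h𝒰.mem_of_mem hU)
  have bipolar_eq (U : Set E) (hU : U ∈ 𝒰) :
      (topDualPairing 𝕜 E).polar (StrongDual.polar 𝕜 U) = U :=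
    bipolar_eq_self (h𝒰' U hU).1 (h𝒰' U hU).2 ⟨0, @mem_of_mem_nhds E τ 0 U (h𝒰.mem_of_mem hU)⟩
  have nhds_zero : @nhds E τ 0 = comap (bidualEval 𝕜 E) (𝓝 0) := by
    refine le_antisymm ?_ (h𝒰.ge_iff.2 fun U hU => ?_)
    · exact (hasBasis_nhds_zero_strongDual.comap (bidualEval 𝕜 E)).ge_iff.2 polar_mem_nhds
    · exact mem_comap.2 ⟨_, hasBasis_nhds_zero_strongDual.mem_of_mem (isVonNBounded_polar U hU),
        (bipolar_eq U hU).subset⟩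
  let _ := τ
  exact IsTopologicalAddGroup.isInducing_iff_nhds_zero.2 nhds_zero

end Bidual

section WeakStarTopology

theorem isLCHausdorff_induced {𝕜 : Type} [RCLike 𝕜] {E : Type u} [AddCommGroup E] [Module 𝕜 E]
    {F : Type*} [AddCommGroup F] [Module 𝕜 F] [TopologicalSpace F] [IsTopologicalAddGroup F]
    [ContinuousSMul 𝕜 F] [LocallyConvexSpace 𝕜 F] [T2Space F] {f : E →ₗ[𝕜] F}
    (hf : Function.Injective f) : IsLCHausdorff 𝕜 (TopologicalSpace.induced f inferInstance) where
  isTopologicalAddGroup := topologicalAddGroup_induced f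
  continuousSMul := continuousSMul_induced f
  locallyConvexSpace := LocallyConvexSpace.induced f
  t2Space := by
    let _ : TopologicalSpace E := TopologicalSpace.induced f inferInstance
    exact T2Space.of_injective_continuous hf continuous_induced_dom

variable {𝕜 : Type} [RCLike 𝕜] {X : Type u} [AddCommGroup X] [Module 𝕜 X] [τ : TopologicalSpace X]
  {Y : Type*} [AddCommGroup Y] [Module 𝕜 Y] [TopologicalSpace Y]

/-- The topology that a space identified with the strong dual of `Y` receives from the weak-*
topology of that dual. -/
noncomputable abbrev weakStarTopology (e : X ≃L[𝕜] StrongDual 𝕜 Y) : TopologicalSpace X :=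
  .induced (StrongDual.toWeakDual.toLinearMap ∘ₗ e.toLinearMap) inferInstance

theorem isLCHausdorff_weakStarTopology (e : X ≃L[𝕜] StrongDual 𝕜 Y) :
    IsLCHausdorff 𝕜 (weakStarTopology e) :=
  isLCHausdorff_induced (StrongDual.toWeakDual.injective.comp e.injective)

variable [ContinuousSMul 𝕜 Y]

theorem hasBasis_nhds_zero_preimage_polar (e : X ≃L[𝕜] StrongDual 𝕜 Y) :
    (𝓝 (0 : X)).HasBasis (IsVonNBounded 𝕜) fun B : Set Y => e ⁻¹' StrongDual.polar 𝕜 B := by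
  rw [e.toHomeomorph.isInducing.nhds_eq_comap]
  have basis := (hasBasis_nhds_zero_strongDual (𝕜 := 𝕜) (E := Y)).comap e
  rwa [← map_zero e] at basis

theorem cnc_weakStarTopology (e : X ≃L[𝕜] StrongDual 𝕜 Y) : CNC 𝕜 τ (weakStarTopology e) := by
  refine ⟨{U | ∃ B, IsVonNBounded 𝕜 B ∧ e ⁻¹' StrongDual.polar 𝕜 B = U},
    (hasBasis_nhds_zero_preimage_polar e).to_hasBasis
      (fun B hB => ⟨_, ⟨B, hB, rfl⟩, Subset.rfl⟩) ?_, ?_⟩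
  · rintro _ ⟨B, hB, rfl⟩
    exact ⟨B, hB, Subset.rfl⟩
  · rintro _ ⟨B, -, rfl⟩
    exact ⟨absConvex_preimage (absConvex_polar _ _) e.toLinearMap,
      isClosed_induced_iff.2 ⟨_, WeakDual.isClosed_polar 𝕜 B, rfl⟩⟩

theorem isCompact_weakStarTopology_preimage_polar [IsTopologicalAddGroup Y]
    (e : X ≃L[𝕜] StrongDual 𝕜 Y) {V : Set Y} (hV : V ∈ 𝓝 (0 : Y)) :
    @IsCompact X (weakStarTopology e) (e ⁻¹' StrongDual.polar 𝕜 V) := by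
  refine @IsInducing.isCompact_preimage' X _ (weakStarTopology e) _ _ (IsInducing.induced _) _
    (isCompact_weakDual_polar hV) fun f _ => ?_
  exact StrongDual.toWeakDual.surjective.comp e.surjective f

theorem bbc_weakStarTopology [IsTopologicalAddGroup Y] [BarrelledSpace 𝕜 Y]
    (e : X ≃L[𝕜] StrongDual 𝕜 Y) : BBC 𝕜 τ (weakStarTopology e) := by
  intro B hB
  have isVonNBounded_image : IsVonNBounded 𝕜 (e '' B) := hB.image e.toContinuousLinearMap
  have prepolar_mem_nhds : (topDualPairing 𝕜 Y).polar (e '' B) ∈ 𝓝 (0 : Y) :=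
    polar_mem_nhds_zero_of_absorbent fun y =>
      isVonNBounded_strongDual_iff.1 isVonNBounded_image {y} (isVonNBounded_singleton y)
  have isVonNBounded_bipolar :
      IsVonNBounded 𝕜 (StrongDual.polar 𝕜 ((topDualPairing 𝕜 Y).polar (e '' B))) :=
    isVonNBounded_polar_of_absorbs fun s hs => hs prepolar_mem_nhds
  refine ⟨e ⁻¹' StrongDual.polar 𝕜 ((topDualPairing 𝕜 Y).polar (e '' B)),
    image_subset_iff.1 (LinearMap.subset_bipolar (topDualPairing 𝕜 Y) _),
    absConvex_preimage (absConvex_polar _ _) e.toLinearMap, ?_,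
    isCompact_weakStarTopology_preimage_polar e prepolar_mem_nhds⟩
  rw [← ContinuousLinearEquiv.image_symm_eq_preimage]
  exact isVonNBounded_bipolar.image e.symm.toContinuousLinearMap

end WeakStarTopology

section SameBounded

variable {𝕜 : Type} [RCLike 𝕜] {E : Type u} [AddCommGroup E] [Module 𝕜 E]
  {τ : TopologicalSpace E} [γ : TopologicalSpace E]

theorem BBC.bbcl (hγ : T2Space E) (hB : BBC 𝕜 τ γ) : BBCl 𝕜 τ γ := by
  intro B h
  obtain ⟨C, hBC, hC, hCb, hCc⟩ := hB B h
  exact ⟨C, hBC, hC, hCb, hCc.isClosed⟩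

theorem BBC.montelSpace (hB : BBC 𝕜 τ γ) (hS : SameBounded 𝕜 τ γ) : MontelSpace 𝕜 E where
  heine_borel B hBc hBb := by
    obtain ⟨C, hBC, -, -, hCc⟩ := hB B ((hS B).2 hBb)
    exact hCc.of_isClosed_subset hBc hBC

variable [ContinuousSMul 𝕜 E]

theorem BBC.isSemiReflexive (hB : BBC 𝕜 τ γ) (hS : SameBounded 𝕜 τ γ) : IsSemiReflexive 𝕜 γ := by
  refine isSemiReflexive_iff_surjective_bidualEval.2
    (surjective_bidualEval_of_exists_isCompact fun B hBb => ?_)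
  obtain ⟨C, hBC, hC, -, hCc⟩ := hB B ((hS B).2 hBb)
  exact ⟨C, hBC, hC, hCc⟩

variable [IsTopologicalAddGroup E] [LocallyConvexSpace 𝕜 E]

theorem sameBounded_of_bbc_of_cnc (hτ : @ContinuousSMul 𝕜 E _ _ τ) (hB : BBC 𝕜 τ γ)
    (hC : CNC 𝕜 τ γ)
    (hcont : ∀ f : E →ₗ[𝕜] 𝕜, (∀ B, BoundedIn 𝕜 τ B → ContinuousOn f B) → Continuous f) :
    SameBounded 𝕜 τ γ := by
  refine fun S => ⟨fun hS => ?_, fun hS => ?_⟩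
  · obtain ⟨C, hSC, -, -, hCc⟩ := hB S hS
    exact (hCc.isVonNBounded 𝕜).subset hSC
  · obtain ⟨𝒰, h𝒰, h𝒰'⟩ := hC
    intro V hV
    obtain ⟨U, hU, hUV⟩ := h𝒰.mem_iff.1 hV
    have absorbs_of_boundedIn (A : Set E) (hA : BoundedIn 𝕜 τ A) : Absorbs 𝕜 U A :=
      hA (h𝒰.mem_of_mem hU)
    refine Absorbs.mono_left ?_ hUV
    exact absorbs_of_absorbent_polar (h𝒰' U hU).1 (h𝒰' U hU).2
      (@absorbent_nhds_zero 𝕜 E _ _ _ U τ hτ (h𝒰.mem_of_mem hU))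
      (fun f hf => hcont f fun A hA => hf A (absorbs_of_boundedIn A hA))
      (absorbent_polar_of_isVonNBounded hS)

end SameBounded

section GammaTilde

variable {𝕜 : Type} [RCLike 𝕜] {E : Type u} [AddCommGroup E] [Module 𝕜 E]
  {τ τ' : TopologicalSpace E}

/- The topology generated by `f` and `γ̃` agrees with `τ'` on the bounded sets, so it is not finer
than `γ̃`. -/
theorem continuous_gammaTilde_of_continuousOn (h' : IsLCHausdorff 𝕜 τ') (f : E →ₗ[𝕜] 𝕜)
    (hf : ∀ B, BoundedIn 𝕜 τ B → @ContinuousOn E 𝕜 (gammaTilde 𝕜 τ τ') _ f B) :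
    @Continuous E 𝕜 (gammaTilde 𝕜 τ τ') _ f := by
  obtain ⟨⟨hγ, hagree⟩, hleast⟩ := isLeast_gammaTilde (τ := τ) h'
  rw [continuous_iff_le_induced]
  refine (hleast (a := gammaTilde 𝕜 τ τ' ⊓ TopologicalSpace.induced f inferInstance)
    ⟨⟨?_, ?_, ?_, ?_⟩, fun B hB => ?_⟩).trans inf_le_right
  · exact topologicalAddGroup_inf hγ.isTopologicalAddGroup (topologicalAddGroup_induced f)
  · exact @continuousSMul_inf _ _ _ _ _ _ hγ.continuousSMul (continuousSMul_induced f)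
  · exact hγ.locallyConvexSpace.inf (LocallyConvexSpace.induced f)
  · exact t2Space_antitone inf_le_left hγ.t2Space
  · rw [induced_inf, ← hagree B hB, inf_eq_left, induced_compose, ← continuous_iff_le_induced]
    exact (@continuousOn_iff_continuous_domRestrict E 𝕜 (gammaTilde 𝕜 τ τ') _ f B).1 (hf B hB)

theorem CNC.to_gammaTilde (h' : IsLCHausdorff 𝕜 τ') (hC : CNC 𝕜 τ τ') :
    CNC 𝕜 τ (gammaTilde 𝕜 τ τ') := by
  obtain ⟨𝒰, h𝒰, h𝒰'⟩ := hC
  refine ⟨𝒰, h𝒰, fun U hU => ⟨(h𝒰' U hU).1, (h𝒰' U hU).2.mono ?_⟩⟩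
  exact (isLeast_gammaTilde h').2 ⟨h', fun _ _ => rfl⟩

theorem BBC.to_gammaTilde (h' : IsLCHausdorff 𝕜 τ') (hB : BBC 𝕜 τ τ') :
    BBC 𝕜 τ (gammaTilde 𝕜 τ τ') := by
  intro B h
  obtain ⟨C, hBC, hC, hCb, hCc⟩ := hB B h
  have compactSpace : @CompactSpace C ((gammaTilde 𝕜 τ τ').induced Subtype.val) := by
    rw [(isLeast_gammaTilde h').1.2 C hCb]
    exact (@isCompact_iff_compactSpace E τ' C).1 hCc
  exact ⟨C, hBC, hC, hCb, (@isCompact_iff_compactSpace E (gammaTilde 𝕜 τ τ') C).2 compactSpace⟩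

theorem sameBounded_gammaTilde (hτ : @ContinuousSMul 𝕜 E _ _ τ) (h' : IsLCHausdorff 𝕜 τ')
    (hB : BBC 𝕜 τ τ') (hC : CNC 𝕜 τ τ') : SameBounded 𝕜 τ (gammaTilde 𝕜 τ τ') := by
  obtain ⟨_, _, _, _⟩ := (isLeast_gammaTilde (τ := τ) h').1.1
  exact sameBounded_of_bbc_of_cnc (γ := gammaTilde 𝕜 τ τ') hτ (hB.to_gammaTilde h')
    (hC.to_gammaTilde h') (continuous_gammaTilde_of_continuousOn h')

theorem isSemiReflexive_gammaTilde (h' : IsLCHausdorff 𝕜 τ') (hB : BBC 𝕜 τ τ')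
    (hS : SameBounded 𝕜 τ (gammaTilde 𝕜 τ τ')) : IsSemiReflexive 𝕜 (gammaTilde 𝕜 τ τ') := by
  obtain ⟨_, _, _, _⟩ := (isLeast_gammaTilde (τ := τ) h').1.1
  exact (hB.to_gammaTilde h').isSemiReflexive (γ := gammaTilde 𝕜 τ τ') hS

theorem completeSpace_strongDual_gammaTilde (h' : IsLCHausdorff 𝕜 τ')
    (hS : SameBounded 𝕜 τ (gammaTilde 𝕜 τ τ')) :
    let _ := gammaTilde 𝕜 τ τ'
    CompleteSpace (StrongDual 𝕜 E) := by
  obtain ⟨_, _, _, _⟩ := (isLeast_gammaTilde (τ := τ) h').1.1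
  intro _
  exact completeSpace_strongDual_of_continuousOn fun f hf =>
    continuous_gammaTilde_of_continuousOn h' f fun B hB => hf B ((hS B).1 hB)

end GammaTilde

section Predual

theorem isCompleteTVS_iff {F : Type u} [AddCommGroup F] [UniformSpace F] [IsUniformAddGroup F] :
    IsCompleteTVS F ↔ CompleteSpace F := by
  rw [IsCompleteTVS, IsUniformAddGroup.rightUniformSpace_eq]

theorem nonempty_continuousLinearEquiv_of_isInducing {𝕜 E F : Type*} [Semiring 𝕜]
    [AddCommMonoid E] [Module 𝕜 E] [TopologicalSpace E] [AddCommMonoid F] [Module 𝕜 F]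
    [TopologicalSpace F] {f : E →ₗ[𝕜] F} (hf : Function.Bijective f) (hi : IsInducing f) :
    Nonempty (E ≃L[𝕜] F) :=
  ⟨⟨.ofBijective f hf, hi.continuous,
    ((LinearEquiv.ofBijective f hf).toEquiv.toHomeomorphOfIsInducing hi).symm.continuous⟩⟩

variable {𝕜 : Type} [RCLike 𝕜] {E : Type u} [AddCommGroup E] [Module 𝕜 E]

theorem HasSemiMontelPrebidual.hasCompleteBarrelledPredual [TopologicalSpace E]
    (h : HasSemiMontelPrebidual 𝕜 E) : HasCompleteBarrelledPredual 𝕜 E := by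
  obtain ⟨Y, _, _, _, _, _, _, _, _, hc, he⟩ := h
  exact ⟨StrongDual 𝕜 Y, inferInstance, inferInstance, inferInstance, inferInstance,
    inferInstance, inferInstance, inferInstance, hc, barrelledSpace_strongDual_of_montelSpace, he⟩

theorem HasCompleteBarrelledPredual.exists_bbc_cnc [τ : TopologicalSpace E]
    (h : HasCompleteBarrelledPredual 𝕜 E) :
    ∃ τ' : TopologicalSpace E, IsLCHausdorff 𝕜 τ' ∧ BBC 𝕜 τ τ' ∧ CNC 𝕜 τ τ' := by
  obtain ⟨Y, _, _, _, _, _, _, _, _, _, ⟨e⟩⟩ := h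
  exact ⟨weakStarTopology e, isLCHausdorff_weakStarTopology e, bbc_weakStarTopology e,
    cnc_weakStarTopology e⟩

variable {τ τ' : TopologicalSpace E}

theorem nonempty_continuousLinearEquiv_bidual [γ : TopologicalSpace E] [IsTopologicalAddGroup E]
    [ContinuousSMul 𝕜 E] [LocallyConvexSpace 𝕜 E] [T2Space E]
    (hτ : @IsTopologicalAddGroup E τ _) (hE : @IsBornological 𝕜 _ E _ _ τ)
    (hS : SameBounded 𝕜 τ γ) (hC : CNC 𝕜 τ γ) (hR : IsSemiReflexive 𝕜 γ) :
    Nonempty (@ContinuousLinearEquiv 𝕜 𝕜 _ _ (.id 𝕜) (.id 𝕜) _ _ E τ _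
      (StrongDual 𝕜 (StrongDual 𝕜 E)) _ _ _ _) :=
  @nonempty_continuousLinearEquiv_of_isInducing 𝕜 E _ _ _ _ τ _ _ _ (bidualEval 𝕜 E)
    ⟨bidualEval_injective, isSemiReflexive_iff_surjective_bidualEval.1 hR⟩
    (isInducing_bidualEval hτ hE hS hC)

theorem hasCompleteBarrelledPredual_of_isSemiReflexive (hτ : @IsTopologicalAddGroup E τ _)
    (hE : @IsBornological 𝕜 _ E _ _ τ) (h' : IsLCHausdorff 𝕜 τ') (hC : CNC 𝕜 τ τ')
    (hR : IsSemiReflexive 𝕜 (gammaTilde 𝕜 τ τ')) (hS : SameBounded 𝕜 τ (gammaTilde 𝕜 τ τ')) :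
    @HasCompleteBarrelledPredual 𝕜 _ E _ _ τ := by
  obtain ⟨_, _, _, _⟩ := (isLeast_gammaTilde (τ := τ) h').1.1
  let γ := gammaTilde 𝕜 τ τ'
  exact ⟨StrongDual 𝕜 E, inferInstance, inferInstance, inferInstance, inferInstance,
    inferInstance, inferInstance, inferInstance,
    isCompleteTVS_iff.2 (completeSpace_strongDual_gammaTilde h' hS),
    barrelledSpace_strongDual_of_surjective_bidualEval
      (isSemiReflexive_iff_surjective_bidualEval.1 hR),
    nonempty_continuousLinearEquiv_bidual hτ hE hS (hC.to_gammaTilde h') hR⟩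

theorem hasSemiMontelPrebidual_of_bbc (hτ : @IsTopologicalAddGroup E τ _)
    (hE : @IsBornological 𝕜 _ E _ _ τ) (h' : IsLCHausdorff 𝕜 τ') (hB : BBC 𝕜 τ τ')
    (hC : CNC 𝕜 τ τ') (hS : SameBounded 𝕜 τ (gammaTilde 𝕜 τ τ')) :
    @HasSemiMontelPrebidual 𝕜 _ E _ _ τ := by
  obtain ⟨_, _, _, _⟩ := (isLeast_gammaTilde (τ := τ) h').1.1
  let γ := gammaTilde 𝕜 τ τ'
  exact ⟨E, inferInstance, inferInstance, γ, inferInstance, inferInstance, inferInstance,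
    inferInstance, (hB.to_gammaTilde h').montelSpace hS,
    isCompleteTVS_iff.2 (completeSpace_strongDual_gammaTilde h' hS),
    nonempty_continuousLinearEquiv_bidual hτ hE hS (hC.to_gammaTilde h')
      (isSemiReflexive_gammaTilde h' hB hS)⟩

end Predual

theorem mainTheorem1 {𝕜 : Type} [RCLike 𝕜] {X : Type u} [AddCommGroup X] [Module 𝕜 X]
    [τ : TopologicalSpace X] [IsTopologicalAddGroup X] [ContinuousSMul 𝕜 X]
    [LocallyConvexSpace 𝕜 X] [T2Space X] (hX : IsBornological 𝕜 X) :
    List.TFAE [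
      HasCompleteBarrelledPredual 𝕜 X,
      HasSemiMontelPrebidual 𝕜 X,
      ∃ τ' : TopologicalSpace X, IsLCHausdorff 𝕜 τ' ∧ BBC 𝕜 τ τ' ∧ CNC 𝕜 τ τ' ∧
        SameBounded 𝕜 τ (gammaTilde 𝕜 τ τ'),
      ∃ τ' : TopologicalSpace X, IsLCHausdorff 𝕜 τ' ∧ BBCl 𝕜 τ τ' ∧ CNC 𝕜 τ τ' ∧
        IsSemiReflexive 𝕜 (gammaTilde 𝕜 τ τ') ∧
        SameBounded 𝕜 τ (gammaTilde 𝕜 τ τ'),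
      ∃ τ' : TopologicalSpace X, IsLCHausdorff 𝕜 τ' ∧ BBC 𝕜 τ τ' ∧ CNC 𝕜 τ τ'] := by
  tfae_have 1 → 5 := HasCompleteBarrelledPredual.exists_bbc_cnc
  tfae_have 5 → 3 := fun ⟨τ', h', hB, hC⟩ =>
    ⟨τ', h', hB, hC, sameBounded_gammaTilde inferInstance h' hB hC⟩
  tfae_have 3 → 2 := fun ⟨τ', h', hB, hC, hS⟩ =>
    hasSemiMontelPrebidual_of_bbc inferInstance hX h' hB hC hS
  tfae_have 2 → 1 := HasSemiMontelPrebidual.hasCompleteBarrelledPredual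
  tfae_have 3 → 4 := fun ⟨τ', h', hB, hC, hS⟩ =>
    ⟨τ', h', hB.bbcl h'.t2Space, hC, isSemiReflexive_gammaTilde h' hB hS, hS⟩
  tfae_have 4 → 1 := fun ⟨τ', h', _, hC, hR, hS⟩ =>
    hasCompleteBarrelledPredual_of_isSemiReflexive inferInstance hX h' hC hR hS
  tfae_finish
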